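/- **Theorem 1.2.** Call $w=(w_1,\dots,w_n)\in(0,1)^n$ with $w_1+\dots+w_n=1$ a proper weight, and put $\|y\|_w:=\max_{1\le i\le n}|y_i|^{1/w_i}$ for $y\in\mathbb{R}^n$. A vector $x\in\mathbb{R}^n$ is $w$-singular if for every $\delta>0$ there is $Q_0>0$ such that for every real $Q>Q_0$ there are $p\in\mathbb{Z}^n$ and $q\in\mathbb{N}$ with $$\|qx-p\|_w\le\frac{\delta}{Q},\qquad 0<q\le Q.$$ A rational affine hyperplane of $\mathbb{R}^n$ is a set $\{x\in\mathbb{R}^n: a_1x_1+\dots+a_nx_n=b\}$ with $b\in\mathbb{Q}$ and $0\ne(a_1,\dots,a_n)\in\mathbb{Q}^n$; a vector is totally irrational if it lies on no rational affine hyperplane. Let $M\subset\mathbb{R}^n$ be a connected (nonempty, embedded) real-analytic submanifold with $\dim M\ge2$ that is not contained in any rational affine hyperplane. Then there are uncountably many totally irrational vectors $x\in M$ such that $x$ is $w$-singular for every proper weight $w$. -/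

import Mathlib

namespace WeightedSingular

/-- A weight on `ℝ^d`: a vector `w ∈ [0,1]^d` with `w₁ + ⋯ + w_d = 1`. -/
def IsWeight {d : ℕ} (w : Fin d → ℝ) : Prop :=
  (∀ i, w i ∈ Set.Icc (0 : ℝ) 1) ∧ ∑ i, w i = 1

/-- A proper weight: a weight lying in `(0,1)^d`. -/
def IsProperWeight {d : ℕ} (w : Fin d → ℝ) : Prop :=
  IsWeight w ∧ ∀ i, w i ∈ Set.Ioo (0 : ℝ) 1

/-- The quasi-norm `‖x‖_w = max_{w_i ≠ 0} |x_i|^{1/w_i}` (a maximum over a finite index set,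
which is nonempty when `w` is a weight). -/
noncomputable def quasiNorm {d : ℕ} (w x : Fin d → ℝ) : ℝ :=
  ⨆ i : {i : Fin d // w i ≠ 0}, |x i| ^ (1 / w i)

/-- `Sing(W)`: the set of `W`-singular vectors of `ℝ^d`. For every `δ > 0` there is a `Q₀ > 0`,
uniform in `w ∈ W`, such that for all real `Q > Q₀` and all `w ∈ W` the system
`‖q x - p‖_w ≤ δ / Q`, `0 < q ≤ Q` has a solution `(p, q) ∈ ℤ^d × ℕ`. -/
def Sing {d : ℕ} (W : Set (Fin d → ℝ)) : Set (Fin d → ℝ) :=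
  {x | ∀ δ : ℝ, 0 < δ → ∃ Q₀ : ℝ, 0 < Q₀ ∧ ∀ Q : ℝ, Q₀ < Q → ∀ w ∈ W,
    ∃ (p : Fin d → ℤ) (q : ℕ),
      quasiNorm w (fun i => (q : ℝ) * x i - (p i : ℝ)) ≤ δ / Q ∧ 0 < q ∧ (q : ℝ) ≤ Q}

/-- A rational affine hyperplane `{x : a₁ x₁ + ⋯ + a_n x_n = b}` of `ℝ^n`, where `a ∈ ℚ^n` is
nonzero and `b ∈ ℚ`. -/
def IsRationalHyperplane {n : ℕ} (H : Set (Fin n → ℝ)) : Prop :=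
  ∃ (a : Fin n → ℚ) (b : ℚ), a ≠ 0 ∧ H = {x | ∑ i, (a i : ℝ) * x i = (b : ℝ)}

/-- A vector is totally irrational if it lies on no rational affine hyperplane. -/
def IsTotallyIrrational {n : ℕ} (x : Fin n → ℝ) : Prop :=
  ∀ H : Set (Fin n → ℝ), IsRationalHyperplane H → x ∉ H

/-- `M ⊆ ℝ^n` is a `k`-dimensional (embedded) real-analytic submanifold: every point of `M` has
an open neighbourhood `U` in `ℝ^n` such that `M ∩ U` is the image of an open set `V ⊆ ℝ^k` under
a real-analytic immersion `φ : V → ℝ^n` that is a homeomorphism onto its image. -/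
def IsAnalyticSubmanifold {n : ℕ} (k : ℕ) (M : Set (Fin n → ℝ)) : Prop :=
  ∀ x ∈ M, ∃ (U : Set (Fin n → ℝ)) (V : Set (Fin k → ℝ)) (φ : (Fin k → ℝ) → (Fin n → ℝ)),
    IsOpen U ∧ x ∈ U ∧ IsOpen V ∧ AnalyticOnNhd ℝ φ V ∧
      (∀ v ∈ V, Function.Injective (fderiv ℝ φ v)) ∧
      Topology.IsEmbedding (V.domRestrict φ) ∧ φ '' V = M ∩ U

end WeightedSingular

/-!
A point on a hyperplane `x_j = r` with `r` rational is approximable with a power of `Q` to spare: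
denominators divisible by that of `r` make the `j`-th coordinate exact, and Dirichlet's theorem in
the other coordinates gains the factor `Q ^ w_j`. The threshold `T` from which on this works is
uniform in the point and in all weights whose entries are at least `ε`, and on a bounded range of
`Q` the approximations survive a small perturbation of the point
(`exists_approx_near_rational_coord`). Hence `x` is singular for all proper weights as soon as
there are hyperplanes `x_{j_N} = r_N` with thresholds `T_N → ∞` such that `x` is sufficiently close
to the `N`-th one, in terms of `T_{N+1}` (`mem_Sing_of_forall_range`).

Such points are found on `M` by Khintchine's nested construction. By the inverse function theorem
`M` contains a graph over a ball in `k` of the coordinates of `ℝⁿ`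
(`IsAnalyticSubmanifold.exists_graph`). Since `k ≥ 2`, any point of the ball on a hyperplane
`v_i = r` can be moved slightly within it, so as to lie also on a hyperplane `v_{i'} = r'` with
`i' ≠ i` and `r'` rational; near the new point everything is as close to the former hyperplane as
`r'` demands, and one goes on from the latter. The identity theorem allows the slices and the
balls to be chosen off the zeros of a given nonzero analytic function (`exists_next_ball`).
Every rational affine function is nonzero on the graph, by the identity theorem on the connected
`M`, so all rational hyperplanes are avoided. Any countable set of points is avoided as well, by
keeping away from the values of its members in one coordinate, so the set of points obtained is
uncountable.
-/

namespace WeightedSingular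

open Set Filter Topology

/-! ### Approximation near hyperplanes with one rational coordinate fixed -/

/-- Dirichlet's theorem with a separate precision `1 / K i` for every coordinate. -/
theorem exists_simultaneous_approx {ι : Type*} [Fintype ι] (K : ι → ℕ) (hK : ∀ i, 0 < K i)
    (x : ι → ℝ) :
    ∃ (p : ι → ℤ) (q : ℕ), 0 < q ∧ q ≤ ∏ i, K i ∧ ∀ i, |q * x i - p i| ≤ 1 / K i := by
  classical
  have hK' : ∀ i, (0 : ℝ) < K i := fun i => by exact_mod_cast hK i
  have hlt : ∀ (m : ℕ) (i : ι), ⌊Int.fract (m * x i) * K i⌋₊ < K i := fun m i => by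
    rw [Nat.floor_lt (mul_nonneg (Int.fract_nonneg _) (hK' i).le)]
    exact mul_lt_of_lt_one_left (hK' i) (Int.fract_lt_one _)
  let f : Fin (∏ i, K i + 1) → (∀ i, Fin (K i)) := fun m i =>
    ⟨⌊Int.fract ((m : ℕ) * x i) * K i⌋₊, hlt m i⟩
  obtain ⟨a, b, hab, hf⟩ := Fintype.exists_ne_map_eq_of_card_lt f (by simp)
  wlog hlt' : (a : ℕ) < b generalizing a b
  · exact this b a hab.symm hf.symm
      (lt_of_le_of_ne (not_lt.mp hlt') fun h => hab (Fin.ext h.symm))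
  refine ⟨fun i => ⌊(b : ℕ) * x i⌋ - ⌊(a : ℕ) * x i⌋, b - a, by omega, by omega, fun i => ?_⟩
  have h1 : ⌊Int.fract ((a : ℕ) * x i) * K i⌋₊ = ⌊Int.fract ((b : ℕ) * x i) * K i⌋₊ := by
    simpa [f] using congrArg Fin.val (congrFun hf i)
  have ha := Nat.floor_le (mul_nonneg (Int.fract_nonneg ((a : ℕ) * x i)) (hK' i).le)
  have hb := Nat.floor_le (mul_nonneg (Int.fract_nonneg ((b : ℕ) * x i)) (hK' i).le)
  have ha' := Nat.lt_floor_add_one (Int.fract ((a : ℕ) * x i) * K i)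
  have hb' := Nat.lt_floor_add_one (Int.fract ((b : ℕ) * x i) * K i)
  rw [h1] at ha ha'
  have key : ((b - a : ℕ) : ℝ) * x i - ((⌊(b : ℕ) * x i⌋ - ⌊(a : ℕ) * x i⌋ : ℤ) : ℝ)
      = Int.fract ((b : ℕ) * x i) - Int.fract ((a : ℕ) * x i) := by
    rw [Nat.cast_sub hlt'.le, Int.fract, Int.fract]
    push_cast
    ring
  rw [key, le_div_iff₀ (hK' i), ← abs_of_pos (hK' i), ← abs_mul, abs_le]
  constructor <;> linarith

/-- If `x j = r` is rational, then denominators divisible by `r.den` cost nothing at the `j`-th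
coordinate, so that Dirichlet's theorem in the other coordinates has a factor `Q ^ w j` to spare.
The bound `T` depends on `x` only through `r`, and not on `w`. -/
theorem exists_approx_of_rational_coord {n : ℕ} (r : ℚ) {ε : ℝ} (hε : 0 < ε) (hε1 : ε ≤ 1) :
    ∃ T : ℝ, 1 ≤ T ∧ ∀ (j : Fin n) (x : Fin n → ℝ), x j = r → ∀ Q : ℝ, T ≤ Q →
      ∀ w : Fin n → ℝ, (∀ i, ε ≤ w i) → ∑ i, w i = 1 →
        ∃ (p : Fin n → ℤ) (q : ℕ), 0 < q ∧ (q : ℝ) ≤ Q ∧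
          ∀ i, |q * x i - p i| ≤ (ε / Q) ^ w i / 2 := by
  set m : ℝ := (r.den : ℝ) with hm
  have hm1 : 1 ≤ m := Nat.one_le_cast.2 r.den_pos
  have hm0 : 0 < m := by linarith
  set A : ℝ := m * (4 * m) ^ n / ε with hA
  have hA1 : 1 ≤ A := by
    rw [hA, le_div_iff₀ hε, one_mul]
    exact hε1.trans (one_le_mul_of_one_le_of_one_le hm1 (one_le_pow₀ (by linarith)))
  -- `A ≤ Q ^ ε` is what makes `m * ∏ i, K i ≤ Q` hold below.
  refine ⟨A ^ (1 / ε), Real.one_le_rpow hA1 (by positivity), ?_⟩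
  intro j x hx Q hQ w hw hsum
  have hQ1 : 1 ≤ Q := (Real.one_le_rpow hA1 (by positivity)).trans hQ
  have hQ0 : 0 < Q := by linarith
  have hAQ : A ≤ Q ^ ε := by
    have := Real.rpow_le_rpow (by positivity) hQ hε.le
    rwa [← Real.rpow_mul (by linarith), one_div_mul_cancel hε.ne', Real.rpow_one] at this
  set B : ℝ := Q / ε with hB
  have hB1 : 1 ≤ B := by rw [hB, le_div_iff₀ hε]; linarith
  have hB0 : 0 < B := by linarith
  have hBw : ∀ i, 1 ≤ B ^ w i := fun i => Real.one_le_rpow hB1 (hε.le.trans (hw i))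
  have hinv : ∀ i, (ε / Q) ^ w i = (B ^ w i)⁻¹ := fun i => by
    rw [← Real.inv_rpow hB0.le, hB, inv_div]
  -- `K j = 1` puts no condition on the `j`-th coordinate; the factor `2 * m` elsewhere absorbs the
  -- later multiplication of the denominator by `m`.
  let K : Fin n → ℕ := fun i => if i = j then 1 else ⌈2 * m * B ^ w i⌉₊
  have hK : ∀ i, 0 < K i := fun i => by
    by_cases h : i = j
    · simp [K, h]
    · simp only [K, h, if_false]
      exact Nat.ceil_pos.2 (by have := hBw i; positivity)
  obtain ⟨p, q, hq0, hq, hp⟩ := exists_simultaneous_approx K hK x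
  have hprod : (∏ i, (K i : ℝ)) ≤ (4 * m) ^ n * (Q ^ (1 - ε) / ε) := by
    have hKj : (K j : ℝ) = 1 := by simp [K]
    rw [← Finset.mul_prod_erase _ _ (Finset.mem_univ j), hKj, one_mul]
    calc ∏ i ∈ Finset.univ.erase j, (K i : ℝ)
        ≤ ∏ i ∈ Finset.univ.erase j, (4 * m * B ^ w i) := by
          refine Finset.prod_le_prod (fun _ _ => by positivity) fun i hi => ?_
          simp only [K, Finset.ne_of_mem_erase hi, if_false]
          have h1 := (Nat.ceil_lt_add_one (a := 2 * m * B ^ w i) (by positivity)).le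
          have h2 : 1 ≤ m * B ^ w i := one_le_mul_of_one_le_of_one_le hm1 (hBw i)
          linarith
      _ = (4 * m) ^ (n - 1) * B ^ (1 - w j) := by
          have hs : ∑ i ∈ Finset.univ.erase j, w i = 1 - w j := by
            rw [← hsum, ← Finset.add_sum_erase _ _ (Finset.mem_univ j)]; ring
          rw [Finset.prod_mul_distrib, Finset.prod_const, Finset.card_erase_of_mem
            (Finset.mem_univ j), Finset.card_univ, Fintype.card_fin,
            ← Real.rpow_sum_of_pos hB0, hs]
      _ ≤ (4 * m) ^ n * B ^ (1 - ε) := by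
          refine mul_le_mul (pow_le_pow_right₀ (by linarith) (Nat.sub_le _ _))
            (Real.rpow_le_rpow_of_exponent_le hB1 (by linarith [hw j])) (by positivity)
            (by positivity)
      _ ≤ _ := by
          refine mul_le_mul_of_nonneg_left ?_ (by positivity)
          rw [hB, Real.div_rpow hQ0.le hε.le]
          refine div_le_div_of_nonneg_left (by positivity) hε ?_
          calc ε = ε ^ (1 : ℝ) := (Real.rpow_one ε).symm
            _ ≤ ε ^ (1 - ε) := Real.rpow_le_rpow_of_exponent_ge hε hε1 (by linarith)
  have hnum : r = (r.num : ℝ) / m := by rw [hm]; exact_mod_cast (Rat.num_div_den r).symm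
  refine ⟨fun i => if i = j then r.num * q else r.den * p i, r.den * q,
    Nat.mul_pos r.den_pos hq0, ?_, fun i => ?_⟩
  · have hq' : (q : ℝ) ≤ ∏ i, (K i : ℝ) := by exact_mod_cast hq
    calc ((r.den * q : ℕ) : ℝ) = m * q := by push_cast; rfl
      _ ≤ m * ((4 * m) ^ n * (Q ^ (1 - ε) / ε)) :=
        mul_le_mul_of_nonneg_left (hq'.trans hprod) hm0.le
      _ = A * Q ^ (1 - ε) := by rw [hA]; ring
      _ ≤ Q ^ ε * Q ^ (1 - ε) := mul_le_mul_of_nonneg_right hAQ (by positivity)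
      _ = Q := by rw [← Real.rpow_add hQ0]; simp
  · by_cases h : i = j
    · subst h
      have : ((r.den * q : ℕ) : ℝ) * x i - ((r.num * q : ℤ) : ℝ) = 0 := by
        rw [hx, hnum]
        push_cast
        rw [← hm]
        field_simp
        ring
      simp only [if_true]
      rw [this, abs_zero]
      positivity
    · have hp' := hp i
      simp only [K, h, if_false] at hp' ⊢
      have hle := Nat.le_ceil (2 * m * B ^ w i)
      have hpos : 0 < 2 * m * B ^ w i := by positivity
      have : ((r.den * q : ℕ) : ℝ) * x i - ((r.den * p i : ℤ) : ℝ) = m * (q * x i - p i) := by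
        push_cast
        ring
      rw [this, abs_mul, abs_of_pos hm0, hinv]
      calc m * |q * x i - p i| ≤ m * (1 / (2 * m * B ^ w i)) :=
            mul_le_mul_of_nonneg_left
              (hp'.trans (one_div_le_one_div_of_le hpos hle)) hm0.le
        _ = (B ^ w i)⁻¹ / 2 := by field_simp

/-- The approximations of `exists_approx_of_rational_coord` persist, up to the factor `2`, on a
neighbourhood of the hyperplane, as long as `Q` stays in a bounded range. -/
theorem exists_approx_near_rational_coord {n : ℕ} (r : ℚ) {ε : ℝ} (hε : 0 < ε) (hε1 : ε ≤ 1) :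
    ∃ T : ℝ, 1 ≤ T ∧ ∀ T' : ℝ, ∃ τ : ℝ, 0 < τ ∧ ∀ (j : Fin n) (x y : Fin n → ℝ), x j = r →
      dist y x < τ → ∀ Q : ℝ, T ≤ Q → Q ≤ T' →
      ∀ w : Fin n → ℝ, (∀ i, ε ≤ w i) → (∀ i, w i ≤ 1) → ∑ i, w i = 1 →
        ∃ (p : Fin n → ℤ) (q : ℕ), 0 < q ∧ (q : ℝ) ≤ Q ∧
          ∀ i, |q * y i - p i| ≤ (ε / Q) ^ w i := by
  obtain ⟨T, hT1, hT⟩ := exists_approx_of_rational_coord (n := n) r hε hε1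
  refine ⟨T, hT1, fun T' => ⟨ε / (2 * (1 + |T'|) ^ 2), by positivity, ?_⟩⟩
  intro j x y hx hxy Q hQ hQT' w hw hw1 hsum
  obtain ⟨p, q, hq0, hqQ, hp⟩ := hT j x hx Q hQ w hw hsum
  refine ⟨p, q, hq0, hqQ, fun i => ?_⟩
  have hQ1 : 1 ≤ Q := hT1.trans hQ
  have hQ0 : 0 < Q := by linarith
  have hεQ : ε / Q ≤ (ε / Q) ^ w i := by
    calc ε / Q = (ε / Q) ^ (1 : ℝ) := (Real.rpow_one _).symm
      _ ≤ _ := Real.rpow_le_rpow_of_exponent_ge (by positivity)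
        (by rw [div_le_one hQ0]; linarith) (hw1 i)
  have hdist : |y i - x i| ≤ ε / (2 * Q ^ 2) := by
    have h1 : |y i - x i| ≤ dist y x := by
      simpa [Real.dist_eq] using dist_le_pi_dist y x i
    refine (h1.trans hxy.le).trans (div_le_div_of_nonneg_left hε.le (by positivity) ?_)
    have : Q ≤ 1 + |T'| := by linarith [le_abs_self T']
    gcongr
  have h2 : |(q : ℝ) * (y i - x i)| ≤ ε / Q / 2 := by
    rw [abs_mul, abs_of_nonneg (Nat.cast_nonneg q)]
    calc (q : ℝ) * |y i - x i| ≤ Q * (ε / (2 * Q ^ 2)) := by gcongr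
      _ = ε / Q / 2 := by field_simp
  calc |q * y i - p i| = |(q * x i - p i) + q * (y i - x i)| := by congr 1; ring
    _ ≤ |q * x i - p i| + |q * (y i - x i)| := abs_add_le _ _
    _ ≤ (ε / Q) ^ w i / 2 + ε / Q / 2 := add_le_add (hp i) h2
    _ ≤ (ε / Q) ^ w i := by linarith

theorem quasiNorm_le_of_abs_le {d : ℕ} {w x : Fin d → ℝ} {t : ℝ} (ht : 0 ≤ t)
    (hw : ∀ i, 0 < w i) (hx : ∀ i, |x i| ≤ t ^ w i) : quasiNorm w x ≤ t := by
  refine Real.iSup_le (fun i => ?_) ht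
  calc |x i| ^ (1 / w i) ≤ (t ^ w i) ^ (1 / w i) :=
        Real.rpow_le_rpow (abs_nonneg _) (hx i) (one_div_nonneg.2 (hw i).le)
    _ = t := by rw [← Real.rpow_mul ht, mul_one_div_cancel (hw i).ne', Real.rpow_one]

/-! ### Analytic functions on slices and on submanifolds -/

theorem analyticOnNhd_affine_comp {n : ℕ} {E : Type*} [NormedAddCommGroup E] [NormedSpace ℝ E]
    {φ : E → Fin n → ℝ} {s : Set E} (hφ : AnalyticOnNhd ℝ φ s) (a : Fin n → ℝ) (b : ℝ) :
    AnalyticOnNhd ℝ (fun v => ∑ i, a i * φ v i - b) s := by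
  intro v hv
  have h : ∀ i, AnalyticAt ℝ (fun v => φ v i) v := fun i =>
    ((ContinuousLinearMap.proj (R := ℝ) (φ := fun _ : Fin n => ℝ) i).analyticAt _).comp (hφ v hv)
  refine AnalyticAt.sub ?_ analyticAt_const
  exact Finset.analyticAt_fun_sum _ fun i _ => analyticAt_const.mul (h i)

/-- Around each of its points, an analytic submanifold is the image of a ball under an analytic
immersion. -/
theorem IsAnalyticSubmanifold.exists_ball_chart {n k : ℕ} {M : Set (Fin n → ℝ)}
    (hM : IsAnalyticSubmanifold k M) {x : Fin n → ℝ} (hx : x ∈ M) :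
    ∃ (O : Set (Fin n → ℝ)) (c : Fin k → ℝ) (ρ : ℝ) (φ : (Fin k → ℝ) → (Fin n → ℝ)),
      IsOpen O ∧ 0 < ρ ∧ φ c = x ∧ AnalyticOnNhd ℝ φ (Metric.ball c ρ) ∧
      (∀ v ∈ Metric.ball c ρ, Function.Injective (fderiv ℝ φ v)) ∧
      φ '' Metric.ball c ρ = M ∩ O := by
  obtain ⟨U, V, φ, hU, hxU, hV, hφ, hinj, hemb, himg⟩ := hM x hx
  obtain ⟨c, hcV, hc⟩ : x ∈ φ '' V := himg ▸ ⟨hx, hxU⟩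
  obtain ⟨ρ, hρ, hball⟩ := Metric.isOpen_iff.1 hV c hcV
  obtain ⟨O, hO, hOeq⟩ := hemb.isInducing.isOpen_iff.1
    (Metric.isOpen_ball.preimage continuous_subtype_val :
      IsOpen ((↑) ⁻¹' Metric.ball c ρ : Set V))
  have hmem : ∀ v ∈ V, (φ v ∈ O ↔ v ∈ Metric.ball c ρ) := fun v hv =>
    Set.ext_iff.1 hOeq ⟨v, hv⟩
  refine ⟨U ∩ O, c, ρ, φ, hU.inter hO, hρ, hc, hφ.mono hball, fun v hv => hinj v (hball hv), ?_⟩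
  rw [← inter_assoc, ← himg]
  ext y
  constructor
  · rintro ⟨v, hv, rfl⟩
    exact ⟨⟨v, hball hv, rfl⟩, (hmem v (hball hv)).2 hv⟩
  · rintro ⟨⟨v, hv, rfl⟩, hy⟩
    exact ⟨v, (hmem v hv).1 hy, rfl⟩

/-- The identity theorem on a connected analytic submanifold, for affine functions. -/
theorem IsAnalyticSubmanifold.affine_eq_of_eventually_eq {n k : ℕ} {M : Set (Fin n → ℝ)}
    (hM : IsAnalyticSubmanifold k M) (hconn : IsPreconnected M) (a : Fin n → ℝ) (b : ℝ)
    {x : Fin n → ℝ} (hx : x ∈ M) (h : ∀ᶠ y in 𝓝[M] x, ∑ i, a i * y i = b) :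
    ∀ y ∈ M, ∑ i, a i * y i = b := by
  set S : Set (Fin n → ℝ) := {x | ∀ᶠ y in 𝓝[M] x, ∑ i, a i * y i = b}
  -- A neighbourhood of `y` in `M` that meets `S` satisfies the equation throughout, so both `S` and
  -- its complement are open in `M`.
  have hext : ∀ y ∈ M, ∃ O, IsOpen O ∧ y ∈ O ∧
      ((∃ z ∈ M ∩ O, z ∈ S) → ∀ z ∈ M ∩ O, ∑ i, a i * z i = b) := by
    intro y hy
    obtain ⟨O, c, ρ, φ, hO, hρ, hc, hφ, -, himg⟩ := hM.exists_ball_chart hy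
    have hcb : c ∈ Metric.ball c ρ := Metric.mem_ball_self hρ
    refine ⟨O, hO, hc ▸ (himg ▸ mem_image_of_mem φ hcb : φ c ∈ M ∩ O).2, ?_⟩
    rintro ⟨z, hz, hzS⟩
    obtain ⟨v, hv, rfl⟩ : z ∈ φ '' Metric.ball c ρ := himg ▸ hz
    have htend : Tendsto φ (𝓝 v) (𝓝[M] (φ v)) := by
      refine tendsto_nhdsWithin_iff.2 ⟨(hφ v hv).continuousAt, ?_⟩
      filter_upwards [Metric.isOpen_ball.mem_nhds hv] with u hu
      exact (himg ▸ mem_image_of_mem φ hu : φ u ∈ M ∩ O).1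
    have hev : (fun u => ∑ i, a i * φ u i - b) =ᶠ[𝓝 v] 0 := by
      filter_upwards [htend.eventually hzS] with u hu
      simp [hu]
    have hzero := (analyticOnNhd_affine_comp hφ a b).eqOn_zero_of_preconnected_of_eventuallyEq_zero
      (convex_ball c ρ).isPreconnected hv hev
    intro z hz
    obtain ⟨u, hu, rfl⟩ : z ∈ φ '' Metric.ball c ρ := himg ▸ hz
    exact sub_eq_zero.1 (hzero hu)
  have hnhd : ∀ O, IsOpen O → (∀ z ∈ M ∩ O, ∑ i, a i * z i = b) → O ⊆ S := by
    intro O hO h z hz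
    filter_upwards [self_mem_nhdsWithin, mem_nhdsWithin_of_mem_nhds (hO.mem_nhds hz)] with u hu hu'
    exact h u ⟨hu, hu'⟩
  choose! O hO hyO hOS using hext
  have hsub : M ⊆ ⋃ y ∈ M ∩ S, O y := by
    by_contra hnot
    obtain ⟨y, hy, hyS⟩ := not_subset.1 hnot
    have hyS' : y ∉ S := fun hyS' => hyS (mem_biUnion (x := y) ⟨hy, hyS'⟩ (hyO y hy))
    obtain ⟨z, hz, hz1, hz2⟩ := hconn (⋃ y ∈ M ∩ S, O y) (⋃ y ∈ M \ S, O y)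
      (isOpen_biUnion fun y hy => hO y hy.1) (isOpen_biUnion fun y hy => hO y hy.1)
      (fun y hy => by
        by_cases hyS : y ∈ S
        · exact Or.inl (mem_biUnion (x := y) ⟨hy, hyS⟩ (hyO y hy))
        · exact Or.inr (mem_biUnion (x := y) ⟨hy, hyS⟩ (hyO y hy)))
      ⟨x, hx, mem_biUnion (x := x) ⟨hx, h⟩ (hyO x hx)⟩
      ⟨y, hy, mem_biUnion (x := y) ⟨hy, hyS'⟩ (hyO y hy)⟩
    obtain ⟨u, hu, hzu⟩ := mem_iUnion₂.1 hz1
    obtain ⟨u', hu', hzu'⟩ := mem_iUnion₂.1 hz2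
    have hzS : z ∈ S := hnhd _ (hO u hu.1) (hOS u hu.1 ⟨u, ⟨hu.1, hyO u hu.1⟩, hu.2⟩) hzu
    exact hu'.2 (hnhd _ (hO u' hu'.1) (hOS u' hu'.1 ⟨z, ⟨hz, hzu'⟩, hzS⟩) (hyO u' hu'.1))
  intro y hy
  obtain ⟨u, hu, hyu⟩ := mem_iUnion₂.1 (hsub hy)
  exact hOS u hu.1 ⟨u, ⟨hu.1, hyO u hu.1⟩, hu.2⟩ y ⟨hy, hyu⟩

/-- An injective linear map into `ℝⁿ` stays injective after projection to suitable coordinates,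
as many as the dimension of its source. -/
theorem exists_coordinates_injective {n k : ℕ} (A : (Fin k → ℝ) →ₗ[ℝ] (Fin n → ℝ))
    (hA : Function.Injective A) :
    ∃ σ : Fin k → Fin n, Function.Injective fun v i => A v (σ i) := by
  let row : Fin n → Module.Dual ℝ (Fin k → ℝ) := fun i => (LinearMap.proj i).comp A
  obtain ⟨κ, a, ha, hspan, hli⟩ := exists_linearIndependent' ℝ row
  have : Fintype κ := Fintype.ofInjective a ha
  have hker : ∀ v, (∀ i, row (a i) v = 0) → v = 0 := by
    intro v hv
    refine (injective_iff_map_eq_zero A).1 hA v (funext fun i => ?_)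
    have hi : row i ∈ Submodule.span ℝ (range (row ∘ a)) :=
      hspan ▸ Submodule.subset_span (mem_range_self i)
    have hle : Submodule.span ℝ (range (row ∘ a)) ≤
        LinearMap.ker (Module.Dual.eval ℝ (Fin k → ℝ) v) := by
      rw [Submodule.span_le]
      rintro _ ⟨i, rfl⟩
      simpa using hv i
    simpa [row] using hle hi
  have hcard : Fintype.card κ ≤ k := by
    simpa [Subspace.dual_finrank_eq] using hli.fintype_card_le_finrank
  have hcard' : k ≤ Fintype.card κ := by
    have : Function.Injective (LinearMap.pi fun i => row (a i)) :=
      (injective_iff_map_eq_zero _).2 fun v hv => hker v fun i => congrFun hv i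
    simpa using LinearMap.finrank_le_finrank_of_injective this
  let e : Fin k ≃ κ := (Fintype.equivFinOfCardEq (le_antisymm hcard hcard')).symm
  refine ⟨fun i => a (e i), fun v v' hvv' => sub_eq_zero.1 (hker _ fun i => ?_)⟩
  have := congrFun hvv' (e.symm i)
  simp only [Equiv.apply_symm_apply] at this
  simp [row, this]

/-- A connected analytic submanifold contains the graph of an analytic map over a ball in some
`k` of the coordinates of `ℝⁿ`, and an affine equation valid on this graph is valid on `M`. -/
theorem IsAnalyticSubmanifold.exists_graph {n k : ℕ} {M : Set (Fin n → ℝ)}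
    (hM : IsAnalyticSubmanifold k M) (hconn : IsConnected M) :
    ∃ (σ : Fin k → Fin n) (c : Fin k → ℝ) (ρ : ℝ) (ψ : (Fin k → ℝ) → (Fin n → ℝ)),
      0 < ρ ∧ AnalyticOnNhd ℝ ψ (Metric.ball c ρ) ∧
      (∀ v ∈ Metric.ball c ρ, ψ v ∈ M ∧ ∀ i, ψ v (σ i) = v i) ∧
      ∀ (a : Fin n → ℝ) (b : ℝ), (∀ v ∈ Metric.ball c ρ, ∑ i, a i * ψ v i = b) →
        ∀ y ∈ M, ∑ i, a i * y i = b := by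
  obtain ⟨x, hx⟩ := hconn.nonempty
  obtain ⟨O, c, ρ, φ, hO, hρ, hc, hφ, hinj, himg⟩ := hM.exists_ball_chart hx
  have hcb : c ∈ Metric.ball c ρ := Metric.mem_ball_self hρ
  obtain ⟨σ, hσ⟩ := exists_coordinates_injective (fderiv ℝ φ c).toLinearMap (hinj c hcb)
  let P : (Fin n → ℝ) →L[ℝ] (Fin k → ℝ) :=
    ContinuousLinearMap.pi fun i => ContinuousLinearMap.proj (σ i)
  have hPinj : Function.Injective (P.comp (fderiv ℝ φ c) : (Fin k → ℝ) →ₗ[ℝ] (Fin k → ℝ)) := hσ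
  let e : (Fin k → ℝ) ≃L[ℝ] (Fin k → ℝ) :=
    (LinearEquiv.ofInjectiveEndo _ hPinj).toContinuousLinearEquiv
  have he : (e : (Fin k → ℝ) →L[ℝ] (Fin k → ℝ)) = P.comp (fderiv ℝ φ c) := by
    ext v i; rfl
  have hG : AnalyticAt ℝ (P ∘ φ) c := (P.analyticAt _).comp (hφ c hcb)
  have hfd : fderiv ℝ (P ∘ φ) c = e := by
    rw [he]
    exact (P.hasFDerivAt.comp c (hφ c hcb).differentiableAt.hasFDerivAt).fderiv
  have hstrict : HasStrictFDerivAt (P ∘ φ) (e : (Fin k → ℝ) →L[ℝ] (Fin k → ℝ)) c :=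
    hfd ▸ hG.hasStrictFDerivAt
  let R := hstrict.toOpenPartialHomeomorph (P ∘ φ)
  have hRcoe : ⇑R = P ∘ φ := hstrict.toOpenPartialHomeomorph_coe
  have hcR : c ∈ R.source := hstrict.mem_toOpenPartialHomeomorph_source
  have hsymm : AnalyticAt ℝ R.symm (R c) := by
    refine R.analyticAt_symm' hcR (i := e) ?_ ?_
    · rw [hRcoe]; exact hG
    · rw [hRcoe]; exact hfd
  have hRc : R.symm (R c) = c := R.left_inv hcR
  have hev : ∀ᶠ v in 𝓝 (R c), v ∈ R.target ∧ R.symm v ∈ Metric.ball c ρ ∧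
      AnalyticAt ℝ R.symm v := by
    refine (R.open_target.eventually_mem (R.map_source hcR)).and
      (Filter.Eventually.and ?_ hsymm.eventually_analyticAt)
    exact hsymm.continuousAt.eventually_mem (Metric.isOpen_ball.mem_nhds (hRc.symm ▸ hcb))
  obtain ⟨ρ', hρ', hball⟩ := Metric.eventually_nhds_iff_ball.1 hev
  refine ⟨σ, R c, ρ', φ ∘ R.symm, hρ', fun v hv => ?_, fun v hv => ⟨?_, fun i => ?_⟩, ?_⟩
  · exact (hφ _ (hball v hv).2.1).comp (hball v hv).2.2
  · exact (himg ▸ mem_image_of_mem φ (hball v hv).2.1 : φ (R.symm v) ∈ M ∩ O).1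
  · have := congrFun (R.right_inv (hball v hv).1) i
    rwa [hRcoe] at this
  · intro a b hab
    have hzero : (fun u => ∑ i, a i * φ u i - b) =ᶠ[𝓝 c] 0 := by
      filter_upwards [R.open_source.mem_nhds hcR,
        (R.continuousAt hcR).eventually_mem (Metric.ball_mem_nhds _ hρ')] with u hu hu'
      have := hab _ hu'
      simp only [Function.comp_apply, R.left_inv hu] at this
      simp [this]
    have hzero' := (analyticOnNhd_affine_comp hφ a b).eqOn_zero_of_preconnected_of_eventuallyEq_zero
      (convex_ball c ρ).isPreconnected hcb hzero
    refine hM.affine_eq_of_eventually_eq hconn.isPreconnected a b hx ?_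
    have hxO : x ∈ O := hc ▸ (himg ▸ mem_image_of_mem φ hcb : φ c ∈ M ∩ O).2
    filter_upwards [self_mem_nhdsWithin, mem_nhdsWithin_of_mem_nhds (hO.mem_nhds hxO)] with y hy hy'
    obtain ⟨u, hu, rfl⟩ : y ∈ φ '' Metric.ball c ρ := himg ▸ ⟨hy, hy'⟩
    exact sub_eq_zero.1 (hzero' hu)

/-! ### Nested balls along rational coordinate hyperplanes -/

/-- The identity theorem on the slice of a ball by a coordinate hyperplane. -/
theorem eq_zero_on_slice {k : ℕ} {c : Fin k → ℝ} {ρ : ℝ} {g : (Fin k → ℝ) → ℝ}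
    (hg : AnalyticOnNhd ℝ g (Metric.ball c ρ)) {i : Fin k} {z : Fin k → ℝ}
    (hz : z ∈ Metric.ball c ρ) (h : ∀ᶠ v in 𝓝 z, v i = z i → g v = 0)
    {w : Fin k → ℝ} (hw : w ∈ Metric.ball c ρ) (hwi : w i = z i) : g w = 0 := by
  let ℓ : ℝ →ᵃ[ℝ] (Fin k → ℝ) := AffineMap.lineMap z w
  have hℓ : ∀ t, ℓ t = z + t • (w - z) := fun t => by
    simp [ℓ, AffineMap.lineMap_apply, add_comm]
  have hℓa : ∀ t, AnalyticAt ℝ ℓ t := fun t => by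
    have : (ℓ : ℝ → Fin k → ℝ) = fun t => z + t • (w - z) := funext hℓ
    rw [this]
    exact analyticAt_const.add (analyticAt_id.smul analyticAt_const)
  have han : AnalyticOnNhd ℝ (g ∘ ℓ) (ℓ ⁻¹' Metric.ball c ρ) := fun t ht =>
    (hg _ ht).comp (hℓa t)
  have h0 : ℓ 0 = z := by simp [ℓ]
  have h1 : ℓ 1 = w := by simp [ℓ]
  have hev : g ∘ ℓ =ᶠ[𝓝 0] 0 := by
    have ht : Tendsto ℓ (𝓝 0) (𝓝 z) := by simpa only [h0] using (hℓa 0).continuousAt.tendsto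
    filter_upwards [ht.eventually h] with t ht
    exact ht (by simp [hℓ, hwi])
  have := han.eqOn_zero_of_preconnected_of_eventuallyEq_zero
    ((convex_ball c ρ).affine_preimage ℓ).isPreconnected
    (show (0 : ℝ) ∈ ℓ ⁻¹' Metric.ball c ρ by rw [mem_preimage, h0]; exact hz) hev
    (show (1 : ℝ) ∈ ℓ ⁻¹' Metric.ball c ρ by rw [mem_preimage, h1]; exact hw)
  simpa [h1] using this

/-- A nonzero analytic function does not vanish on all rational slices `v i = r` that come close
to a given point, since these are dense nearby. -/
theorem exists_rational_slice {k : ℕ} {c : Fin k → ℝ} {ρ : ℝ} {g : (Fin k → ℝ) → ℝ}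
    (hg : AnalyticOnNhd ℝ g (Metric.ball c ρ)) (hg0 : ∃ v ∈ Metric.ball c ρ, g v ≠ 0)
    (i : Fin k) {y : Fin k → ℝ} {δ : ℝ} (hδ : 0 < δ) (hy : Metric.ball y δ ⊆ Metric.ball c ρ) :
    ∃ r : ℚ, |(r : ℝ) - y i| < δ ∧ ∃ v ∈ Metric.ball c ρ, v i = r ∧ g v ≠ 0 := by
  by_contra! hno
  obtain ⟨v, hv, hgv⟩ := hg0
  refine hgv (hg.eqOn_zero_of_preconnected_of_eventuallyEq_zero
    (convex_ball c ρ).isPreconnected (hy (Metric.mem_ball_self hδ)) ?_ hv)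
  filter_upwards [Metric.ball_mem_nhds y hδ] with u hu
  by_contra hgu
  have hcont : ContinuousAt (fun t : ℝ => Function.update u i t) (u i) :=
    (continuous_const.update i continuous_id).continuousAt
  have hgcont : ContinuousAt g (Function.update u i (u i)) := by
    rw [Function.update_eq_self]; exact (hg u (hy hu)).continuousAt
  have hev : ∀ᶠ t in 𝓝 (u i),
      Function.update u i t ∈ Metric.ball y δ ∧ g (Function.update u i t) ≠ 0 := by
    refine (hcont.eventually_mem ?_).and
      ((hgcont.comp (f := fun t : ℝ => Function.update u i t) hcont).eventually_ne ?_)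
    · rw [Function.update_eq_self]; exact Metric.isOpen_ball.mem_nhds hu
    · simpa using hgu
  obtain ⟨ε, hε, hεb⟩ := Metric.eventually_nhds_iff_ball.1 hev
  obtain ⟨r, hr1, hr2⟩ := exists_rat_btwn (show u i < u i + ε by linarith)
  have hr := hεb r (by
    rw [Metric.mem_ball, Real.dist_eq, abs_of_pos (by linarith)]; linarith)
  refine hr.2 (hno r ?_ _ (hy hr.1) (by simp))
  have := (dist_le_pi_dist (Function.update u i (r : ℝ)) y i).trans_lt hr.1
  simpa [Real.dist_eq] using this

/-- One step from the hyperplane `v i = r` to a transversal hyperplane `v i' = r'`: the latter is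
chosen first, and only then the ball, on which `ψ` is so close to its values on the former
hyperplane as a tolerance depending on `r'` demands. -/
theorem exists_next_ball {k : ℕ} [Nontrivial (Fin k)] {X : Type*} [PseudoMetricSpace X]
    {c : Fin k → ℝ} {ρ : ℝ} {ψ : (Fin k → ℝ) → X} (hψ : ContinuousOn ψ (Metric.ball c ρ))
    {g : (Fin k → ℝ) → ℝ} (hg : AnalyticOnNhd ℝ g (Metric.ball c ρ))
    (hg0 : ∃ v ∈ Metric.ball c ρ, g v ≠ 0) {τ : ℚ → ℝ} (hτ : ∀ r, 0 < τ r)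
    {y : Fin k → ℝ} {δ : ℝ} (hδ : 0 < δ) (hy : Metric.ball y δ ⊆ Metric.ball c ρ)
    {i : Fin k} {r : ℚ} (hyi : y i = r) :
    ∃ (y' : Fin k → ℝ) (δ' : ℝ) (i' : Fin k) (r' : ℚ), 0 < δ' ∧
      Metric.closedBall y' δ' ⊆ Metric.ball y δ ∧ y' i' = r' ∧
      ∀ v ∈ Metric.closedBall y' δ', g v ≠ 0 ∧
        ∃ z ∈ Metric.ball c ρ, z i = r ∧ dist (ψ v) (ψ z) < τ r' := by
  obtain ⟨i', hi'⟩ := exists_ne i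
  obtain ⟨r', hr', w, hw, hwi, hgw⟩ := exists_rational_slice hg hg0 i' hδ hy
  set z := Function.update y i' (r' : ℝ) with hz
  have hzi' : z i' = r' := by simp [hz]
  have hzy : z ∈ Metric.ball y δ := by
    refine (dist_pi_lt_iff hδ).2 fun j => ?_
    by_cases h : j = i'
    · subst h; simpa [hz, Real.dist_eq] using hr'
    · simpa [hz, h] using hδ
  have hzB := hy hzy
  have hnear : ∀ᶠ v in 𝓝 z, v ∈ Metric.ball y δ ∧ dist (ψ v) (ψ z) < τ r' :=
    (Metric.isOpen_ball.eventually_mem hzy).and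
      (Metric.tendsto_nhds.1 (hψ.continuousAt (Metric.isOpen_ball.mem_nhds hzB)) _ (hτ r'))
  have hfreq : ∃ᶠ v in 𝓝 z, v i' = z i' ∧ g v ≠ 0 := fun hno =>
    hgw (eq_zero_on_slice hg hzB (hno.mono fun v hv hvi => by_contra fun h => hv ⟨hvi, h⟩) hw
      (hwi.trans hzi'.symm))
  obtain ⟨y', ⟨hy'i, hgy'⟩, hy'⟩ := (hfreq.and_eventually hnear.eventually_nhds).exists
  have hgood := hy'.and
    ((hg y' (hy hy'.self_of_nhds.1)).continuousAt.eventually_ne hgy')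
  obtain ⟨δ', hδ', hball⟩ := Metric.nhds_basis_closedBall.eventually_iff.1 hgood
  refine ⟨y', δ', i', r', hδ', fun v hv => (hball hv).1.1, hy'i.trans hzi', fun v hv =>
    ⟨(hball hv).2, z, hzB, ?_, (hball hv).1.2⟩⟩
  simp [hz, hi'.symm, hyi]

/-- There is a point avoiding the zeros of countably many nonzero analytic functions whose image
under `ψ` is, for every `N`, close to that of a hyperplane `v i = r N`, where the required
closeness `τ N (r N) (r (N + 1))` may depend on the next hyperplane. -/
theorem exists_limit_of_rational_hyperplanes {k : ℕ} [Nontrivial (Fin k)] {X : Type*}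
    [PseudoMetricSpace X] {c : Fin k → ℝ} {ρ : ℝ} (hρ : 0 < ρ) {ψ : (Fin k → ℝ) → X}
    (hψ : ContinuousOn ψ (Metric.ball c ρ))
    {g : ℕ → (Fin k → ℝ) → ℝ} (hg : ∀ N, AnalyticOnNhd ℝ (g N) (Metric.ball c ρ))
    (hg0 : ∀ N, ∃ v ∈ Metric.ball c ρ, g N v ≠ 0)
    {τ : ℕ → ℚ → ℚ → ℝ} (hτ : ∀ N r r', 0 < τ N r r') :
    ∃ v ∈ Metric.ball c ρ, ∃ r : ℕ → ℚ, ∀ N, g N v ≠ 0 ∧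
      ∃ z ∈ Metric.ball c ρ, (∃ i, z i = r N) ∧ dist (ψ v) (ψ z) < τ N (r N) (r (N + 1)) := by
  let State := {s : (Fin k → ℝ) × ℝ × Fin k × ℚ //
    0 < s.2.1 ∧ Metric.closedBall s.1 s.2.1 ⊆ Metric.ball c ρ ∧ s.1 s.2.2.1 = s.2.2.2}
  have hstep : ∀ (N : ℕ) (s : State), ∃ s' : State,
      Metric.closedBall s'.1.1 s'.1.2.1 ⊆ Metric.closedBall s.1.1 s.1.2.1 ∧
      ∀ v ∈ Metric.closedBall s'.1.1 s'.1.2.1, g N v ≠ 0 ∧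
        ∃ z ∈ Metric.ball c ρ, z s.1.2.2.1 = s.1.2.2.2 ∧
          dist (ψ v) (ψ z) < τ N s.1.2.2.2 s'.1.2.2.2 := by
    rintro N ⟨⟨y, δ, i, r⟩, hδ, hy, hyi⟩
    obtain ⟨y', δ', i', r', hδ', hsub, hyi', h⟩ := exists_next_ball hψ (hg N) (hg0 N)
      (hτ N r) hδ (Metric.ball_subset_closedBall.trans hy) hyi
    have hsub' := hsub.trans Metric.ball_subset_closedBall
    exact ⟨⟨⟨y', δ', i', r'⟩, hδ', hsub'.trans hy, hyi'⟩, hsub', h⟩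
  have hinit : Nonempty State := by
    obtain ⟨i, -⟩ := exists_pair_ne (Fin k)
    obtain ⟨r, hr, v, hv, hvi, -⟩ := exists_rational_slice (g := fun _ => 1)
      (c := c) (ρ := ρ) analyticOnNhd_const ⟨c, Metric.mem_ball_self hρ, one_ne_zero⟩ i hρ
      (Subset.refl _)
    obtain ⟨δ, hδ, hsub⟩ := Metric.nhds_basis_closedBall.mem_iff.1 (Metric.isOpen_ball.mem_nhds hv)
    exact ⟨⟨⟨v, δ, i, r⟩, hδ, hsub, hvi⟩⟩
  choose next hnext hgood using hstep
  obtain ⟨s₀⟩ := hinit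
  let s : ℕ → State := fun N => Nat.rec s₀ next N
  obtain ⟨v, hv⟩ := IsCompact.nonempty_iInter_of_sequence_nonempty_isCompact_isClosed
    (fun N => Metric.closedBall (s N).1.1 (s N).1.2.1) (fun N => hnext N (s N))
    (fun N => ⟨_, Metric.mem_closedBall_self (s N).2.1.le⟩) (isCompact_closedBall _ _)
    (fun N => Metric.isClosed_closedBall)
  rw [mem_iInter] at hv
  refine ⟨v, (s 0).2.2.1 (hv 0), fun N => (s N).1.2.2.2, fun N => ?_⟩
  obtain ⟨h1, z, hz, hzi, hd⟩ := hgood N (s N) v (hv (N + 1))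
  exact ⟨h1, z, hz, ⟨_, hzi⟩, hd⟩

/-! ### Singularity from approximations on consecutive ranges -/

/-- The ranges `[T N, T (N + 1)]` cover a half-line, so a vector that is `1 / (N + 1)`-approximable
on the `N`-th range, for all weights with entries at least `1 / (N + 1)`, is singular for every
proper weight. -/
theorem mem_Sing_of_forall_range {n : ℕ} {x : Fin n → ℝ} {T : ℕ → ℝ} (hT : ∀ N : ℕ, N + 1 ≤ T N)
    (h : ∀ N : ℕ, ∀ Q : ℝ, T N ≤ Q → Q ≤ T (N + 1) → ∀ w : Fin n → ℝ,
      (∀ i, 1 / ((N : ℝ) + 1) ≤ w i) → (∀ i, w i ≤ 1) → ∑ i, w i = 1 →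
        ∃ (p : Fin n → ℤ) (q : ℕ), 0 < q ∧ (q : ℝ) ≤ Q ∧
          ∀ i, |q * x i - p i| ≤ (1 / ((N : ℝ) + 1) / Q) ^ w i)
    {w : Fin n → ℝ} (hw : IsProperWeight w) : x ∈ Sing ({w} : Set (Fin n → ℝ)) := by
  intro δ hδ
  have hlim : Tendsto (fun N : ℕ => 1 / ((N : ℝ) + 1)) atTop (𝓝 0) :=
    tendsto_one_div_add_atTop_nhds_zero_nat
  obtain ⟨N₀, hN₀⟩ := eventually_atTop.1 ((hlim.eventually_le_const hδ).and
    (eventually_all.2 fun i => hlim.eventually_le_const (hw.2 i).1))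
  have hTpos : ∀ N, 0 < T N := fun N => lt_of_lt_of_le (by positivity) (hT N)
  refine ⟨T N₀, hTpos N₀, ?_⟩
  intro Q hQ w' hw'
  rw [mem_singleton_iff.1 hw']
  have hQ0 : 0 < Q := (hTpos N₀).trans hQ
  have hex : ∃ m, Q < T (N₀ + m) := by
    obtain ⟨m, hm⟩ := exists_nat_gt Q
    refine ⟨m, hm.trans_le (le_trans ?_ (hT _))⟩
    push_cast
    linarith [(Nat.cast_nonneg N₀ : (0 : ℝ) ≤ N₀)]
  classical
  obtain ⟨m, hm⟩ : ∃ m, Nat.find hex = m + 1 := Nat.exists_eq_succ_of_ne_zero fun h0 => by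
    have := Nat.find_spec hex
    rw [h0] at this
    exact lt_asymm hQ this
  have hlt : Q < T (N₀ + m + 1) := by simpa [hm, add_assoc] using Nat.find_spec hex
  have hge : T (N₀ + m) ≤ Q := not_lt.1 (Nat.find_min hex (by omega : m < Nat.find hex))
  obtain ⟨hNδ, hNw⟩ := hN₀ (N₀ + m) (Nat.le_add_right _ _)
  obtain ⟨p, q, hq0, hqQ, hp⟩ := h (N₀ + m) Q hge hlt.le w hNw (fun i => (hw.2 i).2.le) hw.1.2
  refine ⟨p, q, quasiNorm_le_of_abs_le (by positivity) (fun i => (hw.2 i).1) fun i => ?_,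
    hq0, hqQ⟩
  exact (hp i).trans (Real.rpow_le_rpow (by positivity) (by gcongr) (hw.2 i).1.le)

/-! ### Existence of singular vectors outside a given countable set -/

theorem IsAnalyticSubmanifold.exists_singular_notMem_of_countable {n k : ℕ} (hk : 2 ≤ k)
    {M : Set (Fin n → ℝ)} (hM : IsAnalyticSubmanifold k M) (hconn : IsConnected M)
    (hrat : ∀ H : Set (Fin n → ℝ), IsRationalHyperplane H → ¬ M ⊆ H)
    {S : Set (Fin n → ℝ)} (hcount : S.Countable) :
    ∃ x ∈ M, x ∉ S ∧ IsTotallyIrrational x ∧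
      ∀ w : Fin n → ℝ, IsProperWeight w → x ∈ Sing ({w} : Set (Fin n → ℝ)) := by
  have : Nontrivial (Fin k) := Fin.nontrivial_iff_two_le.2 hk
  obtain ⟨i₀, -⟩ := exists_pair_ne (Fin k)
  obtain ⟨σ, c, ρ, ψ, hρ, hψ, hgraph, hψM⟩ := hM.exists_graph hconn
  -- The affine functions to be avoided: the rational ones, and for each `x ∈ S` the one that
  -- vanishes where the coordinate `σ i₀` agrees with that of `x`.
  let F : Set ((Fin n → ℝ) × ℝ) :=
    (range fun ab : {a : Fin n → ℚ // a ≠ 0} × ℚ => (fun i => (ab.1.1 i : ℝ), (ab.2 : ℝ))) ∪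
      (fun x : Fin n → ℝ => (Pi.single (σ i₀) 1, x (σ i₀))) '' S
  have hFc : F.Countable := (countable_range _).union (hcount.image _)
  have hFne : F.Nonempty := ⟨_, Or.inl ⟨(⟨Pi.single (σ i₀) 1, by simp⟩, 0), rfl⟩⟩
  have hF0 : ∀ ab ∈ F, ∃ v ∈ Metric.ball c ρ, ∑ i, ab.1 i * ψ v i - ab.2 ≠ 0 := by
    intro ab hab
    by_contra! hzero
    rcases hab with ⟨⟨a, b⟩, rfl⟩ | ⟨x, -, rfl⟩
    · exact hrat _ ⟨a.1, b, a.2, rfl⟩ (hψM _ _ fun v hv => sub_eq_zero.1 (hzero v hv))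
    · have hconst : ∀ v ∈ Metric.ball c ρ, v i₀ = x (σ i₀) := fun v hv => by
        have := hzero v hv
        simpa [Pi.single_apply, (hgraph v hv).2, sub_eq_zero] using this
      have h1 := hconst c (Metric.mem_ball_self hρ)
      have h2 := hconst (Function.update c i₀ (c i₀ + ρ / 2)) ((dist_pi_lt_iff hρ).2 fun j => by
        by_cases h : j = i₀
        · subst h; simp [abs_of_pos hρ, hρ]
        · simpa [h] using hρ)
      simp at h2
      linarith
  obtain ⟨ab, hab⟩ := hFc.exists_eq_range hFne
  have hε : ∀ N : ℕ, (0 : ℝ) < 1 / ((N : ℝ) + 1) ∧ 1 / ((N : ℝ) + 1) ≤ 1 := fun N =>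
    ⟨by positivity, (div_le_one (by positivity)).2 (by simp)⟩
  choose T hT1 τ hτ hT using fun (N : ℕ) (r : ℚ) =>
    exists_approx_near_rational_coord (n := n) r (hε N).1 (hε N).2
  -- Raising the thresholds makes them tend to infinity.
  let T' : ℕ → ℚ → ℝ := fun N r => max (T N r) (N + 1)
  obtain ⟨v, hv, r, hr⟩ := exists_limit_of_rational_hyperplanes hρ hψ.continuousOn
    (g := fun N v => ∑ i, (ab N).1 i * ψ v i - (ab N).2)
    (fun N => analyticOnNhd_affine_comp hψ _ _) (fun N => hF0 _ (hab ▸ mem_range_self N))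
    (τ := fun N r r' => τ N r (T' (N + 1) r')) (fun N r r' => hτ N r _)
  have havoid : ∀ p ∈ F, ∑ i, p.1 i * ψ v i ≠ p.2 := fun p hp => by
    obtain ⟨N, rfl⟩ : p ∈ range ab := hab ▸ hp
    exact sub_ne_zero.1 (hr N).1
  refine ⟨ψ v, (hgraph v hv).1, fun hmem => ?_, ?_, fun w hw => ?_⟩
  · exact havoid _ (Or.inr ⟨_, hmem, rfl⟩) (by simp [Pi.single_apply])
  · rintro _ ⟨a, b, ha, rfl⟩ hx
    exact havoid _ (Or.inl ⟨(⟨a, ha⟩, b), rfl⟩) hx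
  · refine mem_Sing_of_forall_range (T := fun N => T' N (r N)) (fun N => le_max_right _ _) ?_ hw
    intro N Q hQ hQ' w hw hw1 hsum
    obtain ⟨-, z, hz, ⟨i, hzi⟩, hd⟩ := hr N
    exact hT N (r N) _ (σ i) (ψ z) (ψ v) (((hgraph z hz).2 i).trans hzi) hd Q
      ((le_max_left _ _).trans hQ) hQ' w hw hw1 hsum

end WeightedSingular

theorem theorem1p2 (n k : ℕ) (hk : 2 ≤ k) (M : Set (Fin n → ℝ))
    (hM : WeightedSingular.IsAnalyticSubmanifold k M) (hconn : IsConnected M)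
    (hrat : ∀ H : Set (Fin n → ℝ), WeightedSingular.IsRationalHyperplane H → ¬ M ⊆ H) :
    ¬ Set.Countable {x : Fin n → ℝ | x ∈ M ∧ WeightedSingular.IsTotallyIrrational x ∧
      ∀ w : Fin n → ℝ, WeightedSingular.IsProperWeight w →
        x ∈ WeightedSingular.Sing ({w} : Set (Fin n → ℝ))} := by
  intro hcount
  obtain ⟨x, hxM, hx, hirr, hsing⟩ :=
    hM.exists_singular_notMem_of_countable hk hconn hrat hcount
  exact hx ⟨hxM, hirr, hsing⟩
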